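/- A mixed multigraph $G$ is a finite vertex set $V$ with a finite multiset of edges, each being an unordered pair (undirected edge) or an ordered pair (directed edge) of vertices. Walks may use an undirected edge in either direction and a directed edge only in its own direction; a cycle is a closed walk with at least one edge that repeats no edge and no vertex, except that its first and last vertices agree. Lengths count edges, and $d(x,y)\in\mathbb{N}\cup\{\infty\}$ is the length of a shortest walk from $x$ to $y$. The eccentricity of a vertex $u$ is $\max_{v}\max\{d(u,v),d(v,u)\}$, and the radius of $G$ is the minimum eccentricity of a vertex. $G$ is $2$-edge-connected if its underlying undirected multigraph is connected and stays connected after the removal of any single undirected edge of $G$. An orientation of $G$ assigns exactly one direction to each undirected edge (directed edges are kept), and the oriented radius of $G$ is the minimum radius of an orientation of $G$. Let $r\in\mathbb{N}$ and let $G$ be a mixed multigraph of (finite) radius $r$. (1) If $G$ is $2$-edge-connected, then the oriented radius of $G$ is finite and at most $1.5\,r^2+r+1$. (2) If $\eta\in\mathbb{N}$ and every edge of $G$ lies in a cycle of $G$ of length at most $\eta$, then the oriented radius of $G$ is finite and at most $1.5\,r\eta$. -/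

import Mathlib

/-- A mixed multigraph with vertex set `V` and edges labelled by `E`: every edge is either
undirected (an unordered pair of vertices, `Sum.inl s(x, y)`) or directed (an ordered pair,
`Sum.inr (x, y)`, pointing from `x` to `y`). Different labels may carry the same pair, so the
edges form a multiset of unordered and ordered pairs. -/
structure MixedGraph (V : Type*) (E : Type*) where
  /-- The pair of vertices carried by an edge. -/
  ends : E → Sym2 V ⊕ V × V

namespace MixedGraph

/-- The edge `e` can be traversed from `x` to `y`: it is an undirected edge `xy`, or it is
directed from `x` to `y`. -/
def Traverses {V E : Type*} (G : MixedGraph V E) (e : E) (x y : V) : Prop :=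
  G.ends e = Sum.inl s(x, y) ∨ G.ends e = Sum.inr (x, y)

/-- Walks in a mixed multigraph, remembering the edges that are used. -/
inductive Walk {V E : Type*} (G : MixedGraph V E) : V → V → Type _
  | nil (x : V) : Walk G x x
  | cons {x y z : V} (e : E) (h : G.Traverses e x y) (p : Walk G y z) : Walk G x z

namespace Walk

/-- The list of edges of a walk. -/
def edges {V E : Type*} {G : MixedGraph V E} : {x y : V} → G.Walk x y → List E
  | _, _, nil _ => []
  | _, _, cons e _ p => e :: p.edges

/-- The list of vertices `v₁, …, vₖ` of a walk. -/
def support {V E : Type*} {G : MixedGraph V E} : {x y : V} → G.Walk x y → List V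
  | _, _, nil x => [x]
  | x, _, cons _ _ p => x :: p.support

/-- The length of a walk: the number of its edges, directed and undirected. -/
def length {V E : Type*} {G : MixedGraph V E} {x y : V} (p : G.Walk x y) : ℕ :=
  p.edges.length

/-- A cycle is a closed walk with at least one edge in which no edge is repeated and no vertex is
repeated, except that the first and the last vertex agree. -/
structure IsCycle {V E : Type*} {G : MixedGraph V E} {x : V} (p : G.Walk x x) : Prop where
  edges_ne_nil : p.edges ≠ []
  edges_nodup : p.edges.Nodup
  support_tail_nodup : p.support.tail.Nodup

end Walk

/-- The distance from `x` to `y`: the length of a shortest walk (equivalently, of a shortest path)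
from `x` to `y`, and `⊤` if there is none. -/
noncomputable def dist {V E : Type*} (G : MixedGraph V E) (x y : V) : ℕ∞ :=
  ⨅ p : G.Walk x y, (p.length : ℕ∞)

/-- The out-eccentricity `max {d(u, v) | v ∈ V}`. -/
noncomputable def outEcc {V E : Type*} (G : MixedGraph V E) (u : V) : ℕ∞ :=
  ⨆ v : V, G.dist u v

/-- The in-eccentricity `max {d(v, u) | v ∈ V}`. -/
noncomputable def inEcc {V E : Type*} (G : MixedGraph V E) (u : V) : ℕ∞ :=
  ⨆ v : V, G.dist v u

/-- The eccentricity of a vertex. -/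
noncomputable def ecc {V E : Type*} (G : MixedGraph V E) (u : V) : ℕ∞ :=
  max (G.outEcc u) (G.inEcc u)

/-- The radius: the minimum eccentricity of a vertex. -/
noncomputable def radius {V E : Type*} (G : MixedGraph V E) : ℕ∞ :=
  ⨅ u : V, G.ecc u

/-- The edge `e` joins `x` and `y` in the underlying undirected multigraph. -/
def Joins {V E : Type*} (G : MixedGraph V E) (e : E) (x y : V) : Prop :=
  G.Traverses e x y ∨ G.Traverses e y x

/-- The underlying undirected multigraph is connected. -/
def Connected {V E : Type*} (G : MixedGraph V E) : Prop :=
  Nonempty V ∧ ∀ x y : V, Relation.ReflTransGen (fun a b => ∃ e : E, G.Joins e a b) x y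

/-- The mixed multigraph obtained by removing the edge `e`. -/
def deleteEdge {V E : Type*} (G : MixedGraph V E) (e : E) : MixedGraph V {e' : E // e' ≠ e} where
  ends e' := G.ends e'.1

/-- A bridge of a connected mixed multigraph: an undirected edge whose removal disconnects the
underlying undirected multigraph. -/
def IsBridge {V E : Type*} (G : MixedGraph V E) (e : E) : Prop :=
  (∃ s : Sym2 V, G.ends e = Sum.inl s) ∧ ¬ (G.deleteEdge e).Connected

/-- A mixed multigraph is 2-edge-connected if it is connected and has no bridges. -/
def TwoEdgeConnected {V E : Type*} (G : MixedGraph V E) : Prop :=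
  G.Connected ∧ ∀ e : E, ¬ G.IsBridge e

/-- `H` is an orientation of `G`: each undirected edge of `G` gets exactly one of its two
directions, and the directed edges are kept. -/
def IsOrientation {V E : Type*} (G H : MixedGraph V E) : Prop :=
  ∀ e : E, ∃ x y : V, G.Traverses e x y ∧ H.ends e = Sum.inr (x, y)

/-- The oriented radius: the minimum radius of an orientation. -/
noncomputable def orientedRadius {V E : Type*} (G : MixedGraph V E) : ℕ∞ :=
  ⨅ H : {H : MixedGraph V E // G.IsOrientation H}, H.1.radius

/-- The edge `e` lies in a cycle of length at most `η`. -/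
def LiesInCycleOfLengthLE {V E : Type*} (G : MixedGraph V E) (e : E) (η : ℕ) : Prop :=
  ∃ (x : V) (p : G.Walk x x), p.IsCycle ∧ e ∈ p.edges ∧ p.length ≤ η

end MixedGraph

/-! Let `u` be a central vertex, and suppose that every edge other than a loop, used in a suitable
direction, can be closed up by at most `n` further steps. The heart is
`exists_partialOrientation_nhd`: some set `S` containing `u` and its neighbours carries a partial
orientation in which every vertex of `S` is within `2n - 1` from `u` and within `n` to `u`.
Contracting `S` to `u` lowers the radius by one and keeps edges closing up, so the rest is oriented
by induction; walks of the contraction lift at the cost of one passage through `S`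
(`OrientBound.succ`). Reversing all arcs exchanges the two costs, so a suitable choice of direction
at each level balances them to about `3n/2` each.

By `WithinRadius.closesUp`, at radius `i` the number `n` may be replaced by `min n (2 * i)`. A cost
of about `3i` at each level sums to the quadratic bound; the constant `n = η - 1` gives the linear
one.

For the neighbourhood, take a maximal set `O` of edges leaving `u` that close up simultaneously
without using `O`, among the sets containing all edges that cannot enter `u` in a short closed walk.
Shortest closing walks for `O` span a hull. By maximality, every neighbour outside the hull is
reached by a short walk from the hull that avoids `u`, and has an edge into `u`. Adding shortest
such walks creates no conflict. -/

namespace MixedGraph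

/-! ### Walks of bounded length -/

/-- There is an `R`-walk with at most `n` steps between two points. -/
inductive Reach {α : Type*} (R : α → α → Prop) : ℕ → α → α → Prop
  | refl (n : ℕ) (x : α) : Reach R n x x
  | head {n : ℕ} {x y z : α} (h : R x y) (p : Reach R n y z) : Reach R (n + 1) x z

namespace Reach

variable {α β : Type*} {R R' : α → α → Prop} {m n : ℕ} {x y z u : α}

theorem mono_le (h : Reach R m x y) (hmn : m ≤ n) : Reach R n x y := by
  induction h generalizing n with
  | refl m x => exact refl n x
  | head h _ ih =>
    obtain ⟨k, rfl⟩ : ∃ k, n = k + 1 := ⟨n - 1, by omega⟩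
    exact head h (ih (by omega))

theorem map (f : α → β) {S : β → β → Prop} (hf : ∀ a b, R a b → S (f a) (f b))
    (h : Reach R n x y) : Reach S n (f x) (f y) := by
  induction h with
  | refl m x => exact refl _ _
  | head h _ ih => exact head (hf _ _ h) ih

theorem mono (hf : ∀ a b, R a b → R' a b) (h : Reach R n x y) : Reach R' n x y :=
  h.map id hf

theorem trans (h : Reach R m x y) (h' : Reach R n y z) : Reach R (m + n) x z := by
  induction h with
  | refl m x => exact h'.mono_le (by omega)
  | head h _ ih => exact (head h (ih h')).mono_le (by omega)

theorem single (h : R x y) : Reach R 1 x y := head h (refl 0 y)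

theorem tail (h : Reach R n x y) (h' : R y z) : Reach R (n + 1) x z := h.trans (single h')

theorem flip (h : Reach R n x y) : Reach (fun a b => R b a) n y x := by
  induction h with
  | refl m x => exact refl _ _
  | head h _ ih => exact ih.tail h

theorem eq_of_zero (h : Reach R 0 x y) : x = y := by
  cases h; rfl

theorem eq_or_head (h : Reach R (n + 1) x z) : x = z ∨ ∃ y, R x y ∧ Reach R n y z := by
  cases h with
  | refl => exact Or.inl rfl
  | head h p => exact Or.inr ⟨_, h, p⟩

theorem reflTransGen (h : Reach R n x y) : Relation.ReflTransGen R x y := by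
  induction h with
  | refl => exact .refl
  | head h _ ih => exact .head h ih

/-- A walk to `u` can be cut at its first visit to `u`. -/
theorem first_hit (h : Reach R n x u) (hx : x ≠ u) :
    ∃ m w, m + 1 ≤ n ∧ w ≠ u ∧ Reach (fun a b => a ≠ u ∧ b ≠ u ∧ R a b) m x w ∧ R w u := by
  induction h with
  | refl => exact absurd rfl hx
  | @head n x y z h p ih =>
    by_cases hy : y = z
    · subst hy
      exact ⟨0, x, by omega, hx, refl _ _, h⟩
    · obtain ⟨m, w, hm, hw, hr, hwu⟩ := ih hy
      exact ⟨m + 1, w, by omega, hw, head ⟨hx, hy, h⟩ hr, hwu⟩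

/-- A walk from `u` can be cut at its last visit to `u`. -/
theorem last_departure (h : Reach R n u x) (hx : x ≠ u) :
    ∃ m w, m + 1 ≤ n ∧ w ≠ u ∧ R u w ∧ Reach (fun a b => a ≠ u ∧ b ≠ u ∧ R a b) m w x := by
  obtain ⟨m, w, hm, hw, hr, hwu⟩ := h.flip.first_hit hx
  exact ⟨m, w, hm, hw, hwu, hr.flip.mono fun a b ⟨h1, h2, h3⟩ => ⟨h2, h1, h3⟩⟩

/-- Walks to `u` lift along a map `c` that is injective away from the fibre of `u`. -/
theorem lift {c : α → β} {S : β → β → Prop} {v : β} {a : ℕ}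
    (hS : ∀ x' y', S x' y' → x' ≠ y' → ∃ x y, c x = x' ∧ c y = y' ∧ R x y)
    (hc : ∀ x y, c x = c y → c x ≠ v → x = y)
    (hu : ∀ x, c x = v → Reach R a x u) {b : β} (h : Reach S n b v) :
    ∀ x, c x = b → Reach R (a + n) x u := by
  induction h with
  | refl n b => exact fun x hx => (hu x hx).mono_le (by omega)
  | @head n b b' v h p ih =>
    intro x hx
    -- The lifted walk stops following `S` at the first visit to `v`, so `a` is paid only once.
    by_cases hb : b = v
    · exact (hu x (hx.trans hb)).mono_le (by omega)
    by_cases hbb : b = b'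
    · exact (ih hc hu x (hx.trans hbb)).mono_le (by omega)
    obtain ⟨x₀, y₀, hx₀, hy₀, hR⟩ := hS _ _ h hbb
    have : x = x₀ := hc _ _ (hx.trans hx₀.symm) (by rw [hx]; exact hb)
    subst this
    exact head hR (ih hc hu y₀ hy₀)

end Reach

/-! ### Shortest walks to a set -/

section Level

variable {α : Type*} {R : α → α → Prop} {T N : Set α} {m n : ℕ} {x y : α}

/-- `n` is the length of a shortest `R`-walk from `x` to the set `T`. -/
def Level (R : α → α → Prop) (T : Set α) (n : ℕ) (x : α) : Prop :=
  (∃ t ∈ T, Reach R n x t) ∧ ∀ m < n, ¬ ∃ t ∈ T, Reach R m x t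

theorem Level.unique (h : Level R T m x) (h' : Level R T n x) : m = n := by
  rcases lt_trichotomy m n with hl | hl | hl
  · exact absurd h.1 (h'.2 m hl)
  · exact hl
  · exact absurd h'.1 (h.2 n hl)

theorem exists_level {t : α} (ht : t ∈ T) (h : Reach R n x t) : ∃ m ≤ n, Level R T m x := by
  classical
  have hex : ∃ n, ∃ t ∈ T, Reach R n x t := ⟨n, t, ht, h⟩
  exact ⟨Nat.find hex, Nat.find_min' hex ⟨t, ht, h⟩, Nat.find_spec hex,
    fun m hm => Nat.find_min hex hm⟩

theorem Level.mem (h : Level R T 0 x) : x ∈ T := by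
  obtain ⟨t, ht, hr⟩ := h.1
  exact hr.eq_of_zero ▸ ht

theorem level_zero (h : x ∈ T) : Level R T 0 x :=
  ⟨⟨x, h, .refl _ _⟩, fun m hm => absurd hm (Nat.not_lt_zero m)⟩

theorem Level.succ (h : Level R T (n + 1) x) : ∃ y, R x y ∧ Level R T n y := by
  obtain ⟨⟨t, ht, hr⟩, hmin⟩ := h
  rcases hr.eq_or_head with rfl | ⟨y, hxy, hy⟩
  · exact absurd ⟨x, ht, .refl 0 x⟩ (hmin 0 (by omega))
  · exact ⟨y, hxy, ⟨t, ht, hy⟩, fun m hm ⟨t', ht', h'⟩ =>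
      hmin (m + 1) (by omega) ⟨t', ht', .head hxy h'⟩⟩

/-- A step of a shortest `R`-walk to `T`. -/
def GeodesicStep (R : α → α → Prop) (T : Set α) (x y : α) : Prop :=
  R x y ∧ ∃ n, Level R T (n + 1) x ∧ Level R T n y

/-- The points on shortest `R`-walks from points of `N` to `T`. -/
def geodesicHull (R : α → α → Prop) (T N : Set α) : Set α :=
  {x | ∃ v ∈ N, Relation.ReflTransGen (GeodesicStep R T) v x}

/-- A step of a shortest `R`-walk from a point of `N` to `T`. -/
def GeodesicArc (R : α → α → Prop) (T N : Set α) (x y : α) : Prop :=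
  x ∈ geodesicHull R T N ∧ GeodesicStep R T x y

theorem subset_geodesicHull (h : x ∈ N) : x ∈ geodesicHull R T N := ⟨x, h, .refl⟩

theorem GeodesicArc.mem_right (h : GeodesicArc R T N x y) : y ∈ geodesicHull R T N := by
  obtain ⟨⟨v, hv, hvx⟩, hxy⟩ := h
  exact ⟨v, hv, hvx.tail hxy⟩

theorem GeodesicArc.asymm (h : GeodesicArc R T N x y) (h' : GeodesicArc R T N y x) : False := by
  obtain ⟨-, -, n, h1, h2⟩ := h
  obtain ⟨-, -, m, h3, h4⟩ := h'
  have := h1.unique h4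
  have := h2.unique h3
  omega

theorem Level.reach_geodesicArc (h : Level R T n x) (hx : x ∈ geodesicHull R T N) :
    ∃ t ∈ T, Reach (GeodesicArc R T N) n x t := by
  induction n generalizing x with
  | zero => exact ⟨x, h.mem, .refl _ _⟩
  | succ n ih =>
    obtain ⟨y, hxy, hy⟩ := h.succ
    have harc : GeodesicArc R T N x y := ⟨hx, hxy, n, h, hy⟩
    obtain ⟨t, ht, hr⟩ := ih hy harc.mem_right
    exact ⟨t, ht, .head harc hr⟩

theorem exists_reach_of_mem_geodesicHull {M : ℕ} (hN : ∀ v ∈ N, ∃ m ≤ M, Level R T m v)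
    (hx : x ∈ geodesicHull R T N) :
    ∃ v ∈ N, ∃ k l, k + l ≤ M ∧ Level R T k x ∧ Reach (GeodesicArc R T N) l v x := by
  obtain ⟨v, hv, hvx⟩ := hx
  refine ⟨v, hv, ?_⟩
  induction hvx with
  | refl =>
    obtain ⟨m, hm, hl⟩ := hN v hv
    exact ⟨m, 0, hm, hl, .refl _ _⟩
  | @tail b c hvb hbc ih =>
    obtain ⟨k, l, hkl, hk, hr⟩ := ih
    obtain ⟨hR, n, h1, h2⟩ := hbc
    have := hk.unique h1
    exact ⟨n, l + 1, by omega, h2, hr.tail ⟨⟨v, hv, hvb⟩, hR, n, h1, h2⟩⟩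

end Level

end MixedGraph
-- Short closed walks through edges that are not bridges
namespace MixedGraph

variable {V E : Type*} {G : MixedGraph V E} {n i : ℕ} {e : E} {x y u : V}

theorem Traverses.eq_or_swap {x' y' : V} (h : G.Traverses e x y) (h' : G.Traverses e x' y') :
    (x = x' ∧ y = y') ∨ (x = y' ∧ y = x') := by
  rcases h with h | h <;> rcases h' with h' | h' <;> rw [h] at h' <;> simp at h'
  · exact h'
  · exact Or.inl h'

/-- There is a step from `x` to `y` along an edge other than `e`. -/
def StepAvoiding (G : MixedGraph V E) (e : E) (x y : V) : Prop :=
  ∃ f, f ≠ e ∧ G.Traverses f x y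

/-- There is a step from `x` to `y` along some edge. -/
def Step (G : MixedGraph V E) (x y : V) : Prop := ∃ f, G.Traverses f x y

/-- Some traversal of the edge `e` can be closed up by a walk of length at most `n` that
avoids `e`. -/
def ClosesUp (G : MixedGraph V E) (n : ℕ) (e : E) : Prop :=
  ∃ x y, G.Traverses e x y ∧ Reach (G.StepAvoiding e) n y x

/-- The vertex `x` is an end of some edge. -/
def Incident (G : MixedGraph V E) (x : V) : Prop := ∃ e y, G.Joins e x y

theorem Traverses.incident_left (h : G.Traverses e x y) : G.Incident x := ⟨e, y, Or.inl h⟩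

theorem Traverses.incident_right (h : G.Traverses e x y) : G.Incident y := ⟨e, x, Or.inr h⟩

/-- A walk that uses the edge `e = xy` can be shortened to use it only once. -/
theorem Reach.avoid_or_once (hends : ∀ a b, G.Traverses e a b → (a = x ∧ b = y) ∨ (a = y ∧ b = x))
    {a b : V} (h : Reach G.Step n a b) :
    Reach (G.StepAvoiding e) n a b ∨ ∃ k l, k + 1 + l ≤ n ∧
      ((Reach (G.StepAvoiding e) k a x ∧ Reach (G.StepAvoiding e) l y b) ∨
        (Reach (G.StepAvoiding e) k a y ∧ Reach (G.StepAvoiding e) l x b)) := by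
  induction h with
  | refl n a => exact Or.inl (.refl _ _)
  | @head n a c b h p ih =>
    obtain ⟨f, hf⟩ := h
    by_cases hfe : f = e
    · subst hfe
      rcases ih with ih | ⟨k, l, hkl, ih⟩
      · right
        refine ⟨0, n, by omega, ?_⟩
        rcases hends _ _ hf with ⟨rfl, rfl⟩ | ⟨rfl, rfl⟩
        · exact Or.inl ⟨.refl _ _, ih⟩
        · exact Or.inr ⟨.refl _ _, ih⟩
      · rcases hends _ _ hf with ⟨rfl, rfl⟩ | ⟨rfl, rfl⟩ <;> rcases ih with ⟨ih1, ih2⟩ | ⟨ih1, ih2⟩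
        · exact Or.inr ⟨0, l, by omega, Or.inl ⟨.refl _ _, ih2⟩⟩
        · exact Or.inl (ih2.mono_le (by omega))
        · exact Or.inl (ih2.mono_le (by omega))
        · exact Or.inr ⟨0, l, by omega, Or.inr ⟨.refl _ _, ih2⟩⟩
    · have hs : G.StepAvoiding e a c := ⟨f, hfe, hf⟩
      rcases ih with ih | ⟨k, l, hkl, ⟨ih1, ih2⟩ | ⟨ih1, ih2⟩⟩
      · exact Or.inl (.head hs ih)
      · exact Or.inr ⟨k + 1, l, by omega, Or.inl ⟨.head hs ih1, ih2⟩⟩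
      · exact Or.inr ⟨k + 1, l, by omega, Or.inr ⟨.head hs ih1, ih2⟩⟩

/-- All ends of edges are within distance `i` from and to `u`. -/
def WithinRadius (G : MixedGraph V E) (i : ℕ) (u : V) : Prop :=
  ∀ x, G.Incident x → Reach G.Step i u x ∧ Reach G.Step i x u

theorem exists_boundary {α : Type*} {R : α → α → Prop} {C : Set α} {a b : α}
    (h : Relation.ReflTransGen R a b) (ha : a ∈ C) (hb : b ∉ C) :
    ∃ p q, R p q ∧ p ∈ C ∧ q ∉ C := by
  induction h with
  | refl => exact absurd ha hb
  | @tail p q _ hpq ih =>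
    by_cases hp : p ∈ C
    · exact ⟨p, q, hpq, hp, hb⟩
    · exact ih hp

/-- Some edge other than `e` joins a vertex `p` lacking a short `e`-avoiding walk from or to `u` to
a vertex `w` having both. The walk missing at `p` must use `e`, which yields a walk between `p` and
`y` and one between `u` and `x`. The opposite connection of `p` with `u`, direct or through `w`,
completes the walk between `x` and `y`. -/
theorem WithinRadius.reach_of_far (hG : G.WithinRadius i u)
    (hends : ∀ a b, G.Traverses e a b → (a = x ∧ b = y) ∨ (a = y ∧ b = x))
    (hconn : Relation.ReflTransGen (fun a b => G.StepAvoiding e a b ∨ G.StepAvoiding e b a) y x)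
    (hx : Reach (G.StepAvoiding e) i u x) (hx' : Reach (G.StepAvoiding e) i x u)
    (hy : ¬ Reach (G.StepAvoiding e) i u y) (hy' : ¬ Reach (G.StepAvoiding e) i y u) :
    Reach (G.StepAvoiding e) (2 * i) y x ∨ Reach (G.StepAvoiding e) (2 * i) x y := by
  have hA : ∀ v, G.Incident v → ¬ Reach (G.StepAvoiding e) i u v → ∃ k l, k + 1 + l ≤ i ∧
      Reach (G.StepAvoiding e) k u x ∧ Reach (G.StepAvoiding e) l y v := by
    intro v hv hn
    rcases (hG v hv).1.avoid_or_once hends with h | ⟨k, l, hkl, h | h⟩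
    · exact absurd h hn
    · exact ⟨k, l, hkl, h⟩
    · exact absurd (h.1.mono_le (by omega)) hy
  have hB : ∀ v, G.Incident v → ¬ Reach (G.StepAvoiding e) i v u → ∃ k l, k + 1 + l ≤ i ∧
      Reach (G.StepAvoiding e) k v y ∧ Reach (G.StepAvoiding e) l x u := by
    intro v hv hn
    rcases (hG v hv).2.avoid_or_once hends with h | ⟨k, l, hkl, h | h⟩
    · exact absurd h hn
    · exact absurd (h.2.mono_le (by omega)) hy'
    · exact ⟨k, l, hkl, h⟩
  obtain ⟨p, w, hpw, hp, hw⟩ := exists_boundary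
    (C := {v | ¬ Reach (G.StepAvoiding e) i u v ∨ ¬ Reach (G.StepAvoiding e) i v u})
    hconn (Or.inl hy) (by simp [hx, hx'])
  simp only [Set.mem_ofPred_eq, not_or, not_not] at hp hw
  have hpi : G.Incident p := by
    rcases hpw with ⟨f, -, hf⟩ | ⟨f, -, hf⟩
    exacts [hf.incident_left, hf.incident_right]
  rcases hpw with hpw | hpw
  · by_cases hpA : Reach (G.StepAvoiding e) i u p
    · obtain ⟨k, l, hkl, h1, h2⟩ := hB p hpi (hp.resolve_left (not_not.2 hpA))
      exact Or.inr (((h2.trans hpA).trans h1).mono_le (by omega))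
    · obtain ⟨k, l, hkl, h1, h2⟩ := hA p hpi hpA
      exact Or.inl ((((h2.tail hpw).trans hw.2).trans h1).mono_le (by omega))
  · by_cases hpB : Reach (G.StepAvoiding e) i p u
    · obtain ⟨k, l, hkl, h1, h2⟩ := hA p hpi (hp.resolve_right (not_not.2 hpB))
      exact Or.inl (((h2.trans hpB).trans h1).mono_le (by omega))
    · obtain ⟨k, l, hkl, h1, h2⟩ := hB p hpi hpB
      exact Or.inr ((((h2.trans hw.1).tail hpw).trans h1).mono_le (by omega))

/-- In a mixed multigraph of radius `i`, an edge that is not a bridge closes up to a cycle of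
length at most `2i + 1`. -/
theorem WithinRadius.closesUp (hG : G.WithinRadius i u) (he : G.Traverses e x y)
    (hconn : G.Traverses e y x →
      Relation.ReflTransGen (fun a b => G.StepAvoiding e a b ∨ G.StepAvoiding e b a) y x) :
    G.ClosesUp (2 * i) e := by
  by_cases he' : G.Traverses e y x
  · have hends : ∀ a b, G.Traverses e a b → (a = x ∧ b = y) ∨ (a = y ∧ b = x) :=
      fun a b h => h.eq_or_swap he
    have hends' : ∀ a b, G.Traverses e a b → (a = y ∧ b = x) ∨ (a = x ∧ b = y) :=
      fun a b h => (h.eq_or_swap he).symm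
    specialize hconn he'
    have hconn' : Relation.ReflTransGen
        (fun a b => G.StepAvoiding e a b ∨ G.StepAvoiding e b a) x y :=
      have : Std.Symm fun a b => G.StepAvoiding e a b ∨ G.StepAvoiding e b a :=
        ⟨fun a b h => h.symm⟩
      Relation.ReflTransGen.stdSymm.symm _ _ hconn
    suffices h : Reach (G.StepAvoiding e) (2 * i) y x ∨ Reach (G.StepAvoiding e) (2 * i) x y by
      rcases h with h | h
      exacts [⟨x, y, he, h⟩, ⟨y, x, he', h⟩]
    by_contra hno
    have h1 : ¬ (Reach (G.StepAvoiding e) i u x ∧ Reach (G.StepAvoiding e) i y u) :=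
      fun h => hno (Or.inl ((h.2.trans h.1).mono_le (by omega)))
    have h2 : ¬ (Reach (G.StepAvoiding e) i u y ∧ Reach (G.StepAvoiding e) i x u) :=
      fun h => hno (Or.inr ((h.2.trans h.1).mono_le (by omega)))
    have hu : Reach (G.StepAvoiding e) i u x ∨ Reach (G.StepAvoiding e) i u y := by
      rcases (hG x he.incident_left).1.avoid_or_once hends with h | ⟨k, l, hkl, h | h⟩
      · exact Or.inl h
      · exact Or.inl (h.1.mono_le (by omega))
      · exact Or.inr (h.1.mono_le (by omega))
    have hu' : Reach (G.StepAvoiding e) i x u ∨ Reach (G.StepAvoiding e) i y u := by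
      rcases (hG x he.incident_left).2.avoid_or_once hends with h | ⟨k, l, hkl, h | h⟩
      · exact Or.inl h
      · exact Or.inr (h.2.mono_le (by omega))
      · exact Or.inl (h.2.mono_le (by omega))
    -- By `h1`, `h2`, `hu` and `hu'`, one end of `e` has short `e`-avoiding walks from and to `u`,
    -- and the other end has neither.
    have key := hG.reach_of_far hends hconn
    have key' := hG.reach_of_far hends' hconn'
    tauto
  · refine ⟨x, y, he, ?_⟩
    -- Here `e` can only be used from `x`, so stopping at the first visit to `x` avoids it.
    have hcut : ∀ {n a}, Reach G.Step n a x → Reach (G.StepAvoiding e) n a x := by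
      intro n a h
      generalize hb : x = b at h
      induction h with
      | refl n a => exact .refl _ _
      | @head n a c b h p ih =>
        subst hb
        obtain ⟨f, hf⟩ := h
        by_cases hfe : f = e
        · subst hfe
          rcases hf.eq_or_swap he with ⟨rfl, rfl⟩ | ⟨rfl, rfl⟩
          · exact .refl _ _
          · exact absurd hf he'
        · exact .head ⟨f, hfe, hf⟩ (ih rfl)
    refine hcut (((hG y he.incident_right).2.trans (hG x he.incident_left).1).mono_le (by omega))

/-! ### Orienting the neighbourhood of the centre -/

/-- A set of arcs that assigns at most one direction to each edge. -/
structure IsPartialOrientation (G : MixedGraph V E) (D : E → V → V → Prop) : Prop where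
  traverses : ∀ e x y, D e x y → G.Traverses e x y
  antisymm : ∀ e x y, D e x y → D e y x → x = y

/-- Steps towards `u` that avoid the edges of `O` and do not leave `u`. -/
def StepInto (G : MixedGraph V E) (u : V) (O : Set E) (x y : V) : Prop :=
  x ≠ u ∧ ∃ e ∉ O, G.Traverses e x y

/-- The edge `e` closes up when used towards `u`. -/
def ClosesInto (G : MixedGraph V E) (n : ℕ) (u : V) (e : E) : Prop :=
  ∃ v ≠ u, G.Traverses e v u ∧ Reach (G.StepAvoiding e) n u v

/-- `O` is a set of edges that leave `u`, contains those that can only leave `u` in a short cycle,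
and all of its members close up simultaneously when used from `u`. -/
structure IsOutSet (G : MixedGraph V E) (n : ℕ) (u : V) (O : Set E) : Prop where
  leaves : ∀ e ∈ O, ∃ v ≠ u, G.Traverses e u v
  forced : ∀ e v, v ≠ u → G.Traverses e u v → ¬ G.ClosesInto n u e → e ∈ O
  reach : ∀ e ∈ O, ∀ v ≠ u, G.Traverses e u v → Reach (G.StepInto u O) n v u

/-- The walk closing up a forced edge `e` enters `u` by an edge `f`. Together with `e` it closes `f`
into `u`, so `f` is not forced. Cut at its first visit to `u`, the walk meets `u` nowhere else,
while forced edges all end at `u`; hence it uses none of them. -/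
theorem isOutSet_forced (hG : ∀ e x y, G.Traverses e x y → x ≠ y → G.ClosesUp n e) (u : V) :
    G.IsOutSet n u {e | ∃ v ≠ u, G.Traverses e u v ∧ ¬ G.ClosesInto n u e} where
  leaves := fun e ⟨v, hv, he, _⟩ => ⟨v, hv, he⟩
  forced := fun e v hv he hn => ⟨v, hv, he, hn⟩
  reach := by
    rintro e ⟨-, -, -, hn⟩ v hv he
    have hr : Reach (G.StepAvoiding e) n v u := by
      obtain ⟨x, y, hxy, hr⟩ := hG e u v he hv.symm
      rcases hxy.eq_or_swap he with ⟨rfl, rfl⟩ | ⟨rfl, rfl⟩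
      · exact hr
      · exact absurd ⟨x, hv, hxy, hr⟩ hn
    obtain ⟨m, w, hm, hw, hrw, f, hfe, hf⟩ := hr.first_hit hv
    have hfin : G.ClosesInto n u f := by
      refine ⟨w, hw, hf, Reach.mono_le (.head ⟨e, hfe.symm, he⟩ (hrw.mono ?_)) hm⟩
      rintro a b ⟨ha, hb, g, -, hg⟩
      refine ⟨g, ?_, hg⟩
      rintro rfl
      rcases hg.eq_or_swap hf with ⟨rfl, rfl⟩ | ⟨rfl, rfl⟩
      exacts [hb rfl, ha rfl]
    refine Reach.mono_le (Reach.tail (hrw.mono ?_) ⟨hw, f, fun ⟨_, _, _, h⟩ => h hfin, hf⟩) hm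
    rintro a b ⟨ha, hb, g, -, hg⟩
    refine ⟨ha, g, ?_, hg⟩
    rintro ⟨z, -, hz, -⟩
    rcases hg.eq_or_swap hz with ⟨rfl, rfl⟩ | ⟨rfl, rfl⟩
    exacts [ha rfl, hb rfl]

/-- The heads of the edges of `O`, used from `u`. -/
def outHeads (G : MixedGraph V E) (u : V) (O : Set E) : Set V :=
  {v | v ≠ u ∧ ∃ e ∈ O, G.Traverses e u v}

/-- The vertices on shortest cycles through the edges of `O`, used from `u`. -/
def outHull (G : MixedGraph V E) (u : V) (O : Set E) : Set V :=
  geodesicHull (G.StepInto u O) {u} (G.outHeads u O)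

/-- An edge from `u` to a vertex outside the hull is not in `O`, hence not forced, so it closes into
`u`. If the closing walk last left `u` by an edge `f` to a vertex outside the hull, then `f` could
be added to `O`. -/
theorem IsOutSet.exists_entry {O : Set E} (hO : Maximal (G.IsOutSet n u) O)
    (hG : ∀ e x y, G.Traverses e x y → x ≠ y → G.ClosesUp n e) {v : V}
    (hv : v ∉ G.outHull u O) (hvu : v ≠ u) (he : G.Joins e u v) :
    G.Traverses e v u ∧ ∃ m z, m + 1 ≤ n ∧ z ≠ u ∧ z ∈ G.outHull u O ∧
      Reach (fun a b => a ≠ u ∧ b ≠ u ∧ G.Step a b) m z v := by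
  have heO : ∀ f w, w ∉ G.outHull u O → w ≠ u → G.Joins f u w → f ∉ O := by
    rintro f w hw hwu hf hfO
    obtain ⟨z, hz, hfz⟩ := hO.prop.leaves f hfO
    have : w = z := by
      rcases hf with hf | hf <;> rcases hf.eq_or_swap hfz with ⟨h1, h2⟩ | ⟨h1, h2⟩ <;>
        first | exact h2 | exact h1 | exact absurd h1.symm hz | exact absurd h1 hwu
    subst this
    exact hw (subset_geodesicHull ⟨hz, f, hfO, hfz⟩)
  have hin : G.ClosesInto n u e := by
    by_contra hn
    rcases he with he | he
    · exact heO e v hv hvu (Or.inl he) (hO.prop.forced e v hvu he hn)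
    · obtain ⟨x, y, hxy, hr⟩ := hG e v u he hvu
      rcases hxy.eq_or_swap he with ⟨rfl, rfl⟩ | ⟨rfl, rfl⟩
      · exact hn ⟨x, hvu, hxy, hr⟩
      · exact heO e y hv hvu (Or.inl hxy) (hO.prop.forced e y hvu hxy hn)
  obtain ⟨v', hv', hev', hr⟩ := hin
  obtain rfl : v' = v := by
    rcases he with he | he <;> rcases hev'.eq_or_swap he with ⟨h1, h2⟩ | ⟨h1, h2⟩ <;>
        first | exact h1 | exact absurd h1 hv'
  refine ⟨hev', ?_⟩
  obtain ⟨m, z, hm, hz, ⟨f, hfe, hf⟩, hr⟩ := hr.last_departure hvu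
  refine ⟨m, z, hm, hz, ?_, hr.mono fun a b ⟨h1, h2, g, _, hg⟩ => ⟨h1, h2, g, hg⟩⟩
  by_contra hzS
  have hfO : f ∉ O := heO f z hzS hz (Or.inl hf)
  -- `f` closes up by the rest of the walk followed by `e ∉ O`; shortest walks for the old members
  -- stay in the hull and so miss `f`.
  have hnew : G.IsOutSet n u (insert f O) := by
    refine ⟨?_, fun g w hw hg hn => Or.inr (hO.prop.forced g w hw hg hn), ?_⟩
    · rintro g (rfl | hg)
      exacts [⟨z, hz, hf⟩, hO.prop.leaves g hg]
    rintro g hg w hw hgw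
    rcases hg with rfl | hg
    · obtain rfl : w = z := by
        rcases hgw.eq_or_swap hf with ⟨h1, h2⟩ | ⟨h1, h2⟩
        exacts [h2, absurd h2 hw]
      refine Reach.mono_le (Reach.tail (hr.mono ?_) ⟨hvu, e, ?_, hev'⟩) hm
      · rintro a b ⟨ha, hb, k, -, hk⟩
        refine ⟨ha, k, ?_, hk⟩
        rintro (rfl | hkO)
        · rcases hk.eq_or_swap hf with ⟨rfl, rfl⟩ | ⟨rfl, rfl⟩
          exacts [ha rfl, hb rfl]
        · obtain ⟨t, -, ht⟩ := hO.prop.leaves k hkO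
          rcases hk.eq_or_swap ht with ⟨rfl, rfl⟩ | ⟨rfl, rfl⟩
          exacts [ha rfl, hb rfl]
      · rintro (rfl | heO')
        exacts [hfe rfl, heO e v' hv hvu he heO']
    · obtain ⟨k, hk, hl⟩ := exists_level (Set.mem_singleton u) (hO.prop.reach g hg w hw hgw)
      obtain ⟨t, rfl, hrt⟩ := hl.reach_geodesicArc (subset_geodesicHull (N := G.outHeads u O)
        ⟨hw, g, hg, hgw⟩)
      refine (hrt.mono ?_).mono_le hk
      rintro a b ⟨haS, ⟨hat, j, hj, hab⟩, -⟩
      refine ⟨hat, j, ?_, hab⟩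
      rintro (rfl | hjO)
      · rcases hab.eq_or_swap hf with ⟨rfl, rfl⟩ | ⟨rfl, rfl⟩
        exacts [hat rfl, hzS haS]
      · exact hj hjO
  exact hfO (hO.le_of_ge hnew (Set.subset_insert f O) (Set.mem_insert f O))

/-- If all edges close up with `n` further steps, then the neighbourhood of `u` can be covered by
a strongly connected partially oriented subgraph with small eccentricities at `u`. -/
theorem exists_partialOrientation_nhd [Finite E]
    (hG : ∀ e x y, G.Traverses e x y → x ≠ y → G.ClosesUp n e) (u : V) :
    ∃ (D : E → V → V → Prop) (S : Set V), G.IsPartialOrientation D ∧ u ∈ S ∧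
      (∀ e x y, D e x y → x ∈ S ∧ y ∈ S) ∧ (∀ e v, G.Joins e u v → v ∈ S) ∧
      ∀ x ∈ S, Reach (fun a b => ∃ e, D e a b) (2 * n - 1) u x ∧
        Reach (fun a b => ∃ e, D e a b) n x u := by
  obtain ⟨O, hO⟩ := (Set.toFinite {O | G.IsOutSet n u O}).exists_maximal ⟨_, isOutSet_forced hG u⟩
  replace hO : Maximal (G.IsOutSet n u) O := hO
  set S₁ := G.outHull u O with hS₁
  set T : Set V := S₁ \ {u} with hT
  set N : Set V := {v | v ∉ S₁ ∧ v ≠ u ∧ ∃ e, G.Joins e u v} with hN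
  set R₁ := G.StepInto u O with hR₁
  -- The relation is reversed: geodesics to `T` for `R₂` are shortest walks of `G` out of `T` that
  -- avoid `u`.
  set R₂ : V → V → Prop := fun b a => a ≠ u ∧ b ≠ u ∧ G.Step a b with hR₂
  set A₁ := GeodesicArc R₁ {u} (G.outHeads u O) with hA₁
  set A₂ := GeodesicArc R₂ T N with hA₂
  -- The clause `e ∉ O` is needed because an edge of `O` may be parallel to an edge used back into
  -- `u`.
  let D : E → V → V → Prop := fun e x y =>
    (x = u ∧ y ≠ u ∧ e ∈ O ∧ G.Traverses e x y) ∨ (e ∉ O ∧ G.Traverses e x y ∧ A₁ x y) ∨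
      (G.Traverses e x y ∧ A₂ y x) ∨ (y = u ∧ x ≠ u ∧ x ∈ N ∧ G.Traverses e x y)
  have a₁l : ∀ {x y}, A₁ x y → x ∈ S₁ := fun h => h.1
  have a₁r : ∀ {x y}, A₁ x y → y ∈ S₁ := fun h => h.mem_right
  have a₁u : ∀ {x y}, A₁ x y → x ≠ u := fun h => h.2.1.1
  have a₂ : ∀ {x y}, A₂ x y → x ∉ S₁ ∧ x ≠ u ∧ y ≠ u := by
    rintro x y ⟨-, ⟨h1, h2, h3⟩, k, hk, -⟩
    exact ⟨fun hx => absurd (hk.unique (level_zero ⟨hx, h2⟩)) (by omega), h2, h1⟩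
  have headS : ∀ {e y}, y ≠ u → e ∈ O → G.Traverses e u y → y ∈ S₁ := fun h1 h2 h3 =>
    subset_geodesicHull ⟨h1, _, h2, h3⟩
  have hlev₁ : ∀ v ∈ G.outHeads u O, ∃ m ≤ n, Level R₁ {u} m v := fun v ⟨hv, e, he, hev⟩ =>
    exists_level (Set.mem_singleton u) (hO.prop.reach e he v hv hev)
  have hentry : ∀ v ∈ N, ∃ m t, m + 1 ≤ n ∧ t ∈ T ∧ Reach R₂ m v t := by
    rintro v ⟨hv, hvu, e, he⟩
    obtain ⟨-, m, z, hm, hz, hzS, hr⟩ := IsOutSet.exists_entry hO hG hv hvu he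
    exact ⟨m, z, hm, ⟨hzS, hz⟩, hr.flip⟩
  have hlev₂ : ∀ v ∈ N, ∃ m ≤ n - 1, Level R₂ T m v := fun v hv => by
    obtain ⟨m, t, hm, ht, hr⟩ := hentry v hv
    obtain ⟨k, hk, hl⟩ := exists_level ht hr
    exact ⟨k, by omega, hl⟩
  have hstep₁ : ∀ a b, A₁ a b → ∃ e, D e a b := by
    intro a b h
    obtain ⟨-, ⟨-, e, he, hab⟩, -⟩ := id h
    exact ⟨e, Or.inr (Or.inl ⟨he, hab, h⟩)⟩
  have hstep₂ : ∀ a b, A₂ b a → ∃ e, D e a b := by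
    intro a b h
    obtain ⟨-, ⟨-, -, e, hab⟩, -⟩ := id h
    exact ⟨e, Or.inr (Or.inr (Or.inl ⟨hab, h⟩))⟩
  have hreach₁ : ∀ x ∈ S₁, x ≠ u → 1 ≤ n ∧ Reach (fun a b => ∃ e, D e a b) n u x ∧
      Reach (fun a b => ∃ e, D e a b) n x u := by
    intro x hx hxu
    obtain ⟨v, ⟨hvu, e, he, hev⟩, k, l, hkl, hk, hr⟩ := exists_reach_of_mem_geodesicHull hlev₁ hx
    obtain ⟨t, rfl, hrt⟩ := hk.reach_geodesicArc hx
    -- Since `k ≥ 1`, the edge out of `u` fits in the budget: `l + 1 ≤ k + l ≤ n`.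
    have hk0 : k ≠ 0 := by
      rintro rfl
      exact hxu hk.mem
    exact ⟨by omega, Reach.mono_le (.head ⟨e, Or.inl ⟨rfl, hvu, he, hev⟩⟩ (hr.mono hstep₁))
      (by omega), (hrt.mono hstep₁).mono_le (by omega)⟩
  refine ⟨D, insert u S₁ ∪ geodesicHull R₂ T N, ⟨?_, ?_⟩, Or.inl (Or.inl rfl), ?_, ?_, ?_⟩
  · rintro e x y (h | h | h | h)
    exacts [h.2.2.2, h.2.1, h.1, h.2.2.2]
  -- Arcs of the third kind avoid `u` and have an end outside `S₁`; those of the fourth join `N` to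
  -- `u`. So only the first two kinds could clash with each other, which membership in `O` excludes;
  -- within a system of geodesics, levels decrease.
  · rintro e x y (h | h | h | h) (h' | h' | h' | h')
    · exact absurd h'.1 h.2.1
    · exact absurd h.2.2.1 h'.1
    · exact absurd h.1 (a₂ h'.2).2.1
    · exact absurd (headS h.2.1 h.2.2.1 (h.1 ▸ h.2.2.2)) h'.2.2.1.1
    · exact absurd h'.2.2.1 h.1
    · exact (h.2.2.asymm h'.2.2).elim
    · exact absurd (a₁l h.2.2) (a₂ h'.2).1
    · exact absurd (a₁r h.2.2) h'.2.2.1.1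
    · exact absurd h'.1 (a₂ h.2).2.1
    · exact absurd (a₁l h'.2.2) (a₂ h.2).1
    · exact (h.2.asymm h'.2).elim
    · exact absurd h'.1 (a₂ h.2).2.2
    · exact absurd (headS h'.2.1 h'.2.2.1 (h'.1 ▸ h'.2.2.2)) h.2.2.1.1
    · exact absurd (a₁r h'.2.2) h.2.2.1.1
    · exact absurd h.1 (a₂ h'.2).2.2
    · exact absurd h'.1 h.2.1
  · rintro e x y (h | h | h | h)
    · exact ⟨Or.inl (Or.inl h.1), Or.inl (Or.inr (headS h.2.1 h.2.2.1 (h.1 ▸ h.2.2.2)))⟩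
    · exact ⟨Or.inl (Or.inr (a₁l h.2.2)), Or.inl (Or.inr (a₁r h.2.2))⟩
    · exact ⟨Or.inr h.2.mem_right, Or.inr h.2.1⟩
    · exact ⟨Or.inr (subset_geodesicHull h.2.2.1), Or.inl (Or.inl h.1)⟩
  · intro e v he
    by_cases hvu : v = u
    · exact Or.inl (Or.inl hvu)
    by_cases hv : v ∈ S₁
    · exact Or.inl (Or.inr hv)
    · exact Or.inr (subset_geodesicHull ⟨hv, hvu, e, he⟩)
  · intro x hx
    by_cases hxu : x = u
    · subst hxu
      exact ⟨.refl _ _, .refl _ _⟩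
    by_cases hxS : x ∈ S₁
    · obtain ⟨h1, h2, h3⟩ := hreach₁ x hxS hxu
      exact ⟨h2.mono_le (by omega), h3⟩
    have hx₂ : x ∈ geodesicHull R₂ T N := by
      rcases hx with (hx | hx) | hx
      exacts [absurd hx hxu, absurd hx hxS, hx]
    obtain ⟨v, hv, k, l, hkl, hk, hr⟩ := exists_reach_of_mem_geodesicHull hlev₂ hx₂
    obtain ⟨t, ht, hrt⟩ := hk.reach_geodesicArc hx₂
    obtain ⟨h1, h2, -⟩ := hreach₁ t ht.1 ht.2
    obtain ⟨hvS, hvu, e, he⟩ := id hv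
    have hev := (IsOutSet.exists_entry hO hG hvS hvu he).1
    -- Outwards, `n` steps to `t` and `n - 1` from there; inwards, `n - 1` steps to `v` and the edge
    -- into `u`.
    exact ⟨(h2.trans (hrt.flip.mono hstep₂)).mono_le (by omega),
      ((hr.flip.mono hstep₂).tail
        ⟨e, Or.inr (Or.inr (Or.inr ⟨rfl, hvu, hv, hev⟩))⟩).mono_le (by omega)⟩

end MixedGraph
namespace MixedGraph

variable {V E : Type*} {G : MixedGraph V E} {n i : ℕ} {e : E} {x y u : V}

/-! ### Contraction and reversal -/

/-- The image of a mixed multigraph under a map of the vertices. -/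
def map (G : MixedGraph V E) (c : V → V) : MixedGraph V E where
  ends e := (G.ends e).map (Sym2.map c) (Prod.map c c)

theorem traverses_map {c : V → V} {x' y' : V} :
    (G.map c).Traverses e x' y' ↔ ∃ x y, c x = x' ∧ c y = y' ∧ G.Traverses e x y := by
  constructor
  · rcases h : G.ends e with s | ⟨a, b⟩
    · induction s using Sym2.ind with
      | _ a b =>
        simp only [Traverses, map, h, Sum.map_inl, Sym2.map_mk, Sum.inl.injEq, reduceCtorEq,
          or_false, Sym2.eq_iff]
        rintro (⟨rfl, rfl⟩ | ⟨rfl, rfl⟩)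
        exacts [⟨a, b, rfl, rfl, Or.inl ⟨rfl, rfl⟩⟩, ⟨b, a, rfl, rfl, Or.inr ⟨rfl, rfl⟩⟩]
    · simp only [Traverses, map, h, Sum.map_inr, reduceCtorEq, false_or, Sum.inr.injEq,
        Prod.map, Prod.mk.injEq]
      rintro ⟨rfl, rfl⟩
      exact ⟨a, b, rfl, rfl, rfl, rfl⟩
  · rintro ⟨x, y, rfl, rfl, h | h⟩
    · exact Or.inl (by simp [map, h])
    · exact Or.inr (by simp [map, h])

theorem incident_map {c : V → V} {x' : V} :
    (G.map c).Incident x' ↔ ∃ x, c x = x' ∧ G.Incident x := by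
  simp only [Incident, Joins, traverses_map]
  constructor
  · rintro ⟨e, y, ⟨a, b, ha, -, h⟩ | ⟨a, b, -, hb, h⟩⟩
    exacts [⟨a, ha, e, b, Or.inl h⟩, ⟨b, hb, e, a, Or.inr h⟩]
  · rintro ⟨x, rfl, e, y, h | h⟩
    exacts [⟨e, c y, Or.inl ⟨x, y, rfl, rfl, h⟩⟩, ⟨e, c y, Or.inr ⟨y, x, rfl, rfl, h⟩⟩]

/-- All directed edges reversed. -/
def reverse (G : MixedGraph V E) : MixedGraph V E where
  ends e := (G.ends e).map id Prod.swap

theorem traverses_reverse : G.reverse.Traverses e x y ↔ G.Traverses e y x := by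
  rcases h : G.ends e with s | ⟨a, b⟩ <;> simp [Traverses, reverse, h, Sym2.eq_swap, and_comm]

/-- All edges other than loops close up with at most `n` further steps. -/
def AllCloseUp (G : MixedGraph V E) (n : ℕ) : Prop :=
  ∀ e x y, G.Traverses e x y → x ≠ y → G.ClosesUp n e

/-- Closing up is phrased with walks because a cycle need not stay a cycle under contraction. -/
theorem ClosesUp.map (h : G.ClosesUp n e) (c : V → V) : (G.map c).ClosesUp n e := by
  obtain ⟨x, y, he, hr⟩ := h
  refine ⟨c x, c y, traverses_map.2 ⟨x, y, rfl, rfl, he⟩, hr.map c ?_⟩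
  rintro a b ⟨f, hf, hab⟩
  exact ⟨f, hf, traverses_map.2 ⟨a, b, rfl, rfl, hab⟩⟩

theorem AllCloseUp.map (h : G.AllCloseUp n) (c : V → V) : (G.map c).AllCloseUp n := by
  intro e x' y' he hne
  obtain ⟨x, y, rfl, rfl, he'⟩ := traverses_map.1 he
  exact (h e x y he' fun h => hne (congrArg c h)).map c

theorem AllCloseUp.reverse (h : G.AllCloseUp n) : G.reverse.AllCloseUp n := by
  intro e x y he hne
  obtain ⟨a, b, hab, hr⟩ := h e y x (traverses_reverse.1 he) hne.symm
  exact ⟨b, a, traverses_reverse.2 hab,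
    hr.flip.mono fun _ _ ⟨f, hf, h⟩ => ⟨f, hf, traverses_reverse.2 h⟩⟩

theorem WithinRadius.reverse (h : G.WithinRadius i u) : G.reverse.WithinRadius i u := by
  rintro x ⟨e, y, hx⟩
  have hx' : G.Incident x := by
    simp only [Joins, traverses_reverse] at hx
    exact ⟨e, y, hx.symm⟩
  exact ⟨(h x hx').2.flip.mono fun _ _ ⟨f, hf⟩ => ⟨f, traverses_reverse.2 hf⟩,
    (h x hx').1.flip.mono fun _ _ ⟨f, hf⟩ => ⟨f, traverses_reverse.2 hf⟩⟩

/-- A closing walk of any length already shows that `e` is not a bridge, so `WithinRadius.closesUp`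
applies at every stage of the contraction. -/
theorem AllCloseUp.min (h : G.AllCloseUp n) (hG : G.WithinRadius i u) :
    G.AllCloseUp (min n (2 * i)) := by
  intro e x y he hne
  rcases le_total n (2 * i) with hle | hle
  · rw [min_eq_left hle]
    exact h e x y he hne
  rw [min_eq_right hle]
  refine hG.closesUp he fun he' => ?_
  have hrt : ∀ {a b}, Reach (G.StepAvoiding e) n a b → Relation.ReflTransGen
      (fun a b => G.StepAvoiding e a b ∨ G.StepAvoiding e b a) a b := by
    intro a b hr
    exact (hr.mono fun _ _ => Or.inl).reflTransGen
  obtain ⟨a, b, hab, hr⟩ := h e x y he hne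
  rcases hab.eq_or_swap he with ⟨rfl, rfl⟩ | ⟨rfl, rfl⟩
  · exact hrt hr
  · have : Std.Symm fun a b => G.StepAvoiding e a b ∨ G.StepAvoiding e b a :=
      ⟨fun a b h => h.symm⟩
    exact Relation.ReflTransGen.stdSymm.symm _ _ (hrt hr)

/-! ### Induction on the radius -/

/-- Mixed multigraphs of radius at most `i` whose edges close up with `n` further steps have
partial orientations with out-eccentricity `A` and in-eccentricity `B` at the centre. -/
def OrientBound (V E : Type*) (n i A B : ℕ) : Prop :=
  ∀ (G : MixedGraph V E) (u : V), G.AllCloseUp n → G.WithinRadius i u →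
    ∃ D : E → V → V → Prop, G.IsPartialOrientation D ∧ ∀ x, G.Incident x →
      Reach (fun a b => ∃ e, D e a b) A u x ∧ Reach (fun a b => ∃ e, D e a b) B x u

variable {A B A' B' : ℕ}

theorem OrientBound.mono (h : OrientBound V E n i A B) (hA : A ≤ A') (hB : B ≤ B') :
    OrientBound V E n i A' B' := by
  intro G u hG hr
  obtain ⟨D, hD, hx⟩ := h G u hG hr
  exact ⟨D, hD, fun x hxi => ⟨(hx x hxi).1.mono_le hA, (hx x hxi).2.mono_le hB⟩⟩

theorem OrientBound.symm (h : OrientBound V E n i A B) : OrientBound V E n i B A := by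
  intro G u hG hr
  obtain ⟨D, hD, hx⟩ := h G.reverse u hG.reverse hr.reverse
  refine ⟨fun e a b => D e b a, ⟨fun e a b hab => traverses_reverse.1 (hD.traverses _ _ _ hab),
    fun e a b h1 h2 => hD.antisymm _ _ _ h2 h1⟩, ?_⟩
  rintro x ⟨e, y, hxe⟩
  have hx' : G.reverse.Incident x :=
    ⟨e, y, by simpa only [Joins, traverses_reverse] using hxe.symm⟩
  exact ⟨(hx x hx').2.flip, (hx x hx').1.flip⟩

theorem orientBound_zero : OrientBound V E n 0 0 0 := by
  intro G u _ hr
  refine ⟨fun _ _ _ => False, ⟨fun _ _ _ h => h.elim, fun _ _ _ h => h.elim⟩, fun x hx => ?_⟩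
  have := (hr x hx).1.eq_of_zero
  subst this
  exact ⟨.refl _ _, .refl _ _⟩

theorem orientBound_of_closesUp_zero : OrientBound V E 0 i 0 0 := by
  intro G u hG hr
  refine orientBound_zero G u hG fun x hx => ?_
  have heq : ∀ a b, G.Step a b → a = b := by
    rintro a b ⟨e, he⟩
    by_contra hne
    obtain ⟨p, q, hpq, h⟩ := hG e a b he hne
    have := h.eq_of_zero
    subst this
    rcases hpq.eq_or_swap he with ⟨h1, h2⟩ | ⟨h1, h2⟩
    exacts [hne (h1.symm.trans h2), hne (h2.symm.trans h1)]
  have : ∀ {k a b}, Reach G.Step k a b → a = b := by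
    intro k a b h
    induction h with
    | refl => rfl
    | head h _ ih => exact (heq _ _ h).trans ih
  have := this (hr x hx).1
  subst this
  exact ⟨.refl _ _, .refl _ _⟩

/-- Orient the neighbourhood of the centre, contract it, and orient the rest. -/
theorem OrientBound.succ [Finite E] (h : OrientBound V E n i A B) :
    OrientBound V E n (i + 1) (A + (2 * min n (2 * (i + 1)) - 1)) (B + min n (2 * (i + 1))) := by
  classical
  intro G u hG hr
  set m := min n (2 * (i + 1)) with hm
  obtain ⟨D, S, hD, huS, hDS, hNS, hS⟩ := exists_partialOrientation_nhd (hG.min hr) u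
  -- The contraction keeps the vertex set `V`; the vertices of `S` other than `u` become isolated,
  -- hence the restriction to incident vertices.
  set c : V → V := fun x => if x ∈ S then u else x with hc
  have hcS : ∀ {x}, x ∈ S → c x = u := fun hx => by simp [hc, hx]
  have hcu : ∀ {x}, c x = u → x ∈ S := fun {x} hx => by
    by_contra hn
    simp only [hc, hn, if_false] at hx
    exact hn (hx ▸ huS)
  have hcinj : ∀ x y, c x = c y → c x ≠ u → x = y := by
    intro x y hxy hx
    have hx' : x ∉ S := fun h => hx (hcS h)
    have hy' : y ∉ S := fun h => hx (hxy.trans (hcS h))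
    simpa [hc, hx', hy'] using hxy
  have hstep : ∀ a b, G.Step a b → (G.map c).Step (c a) (c b) := fun a b ⟨f, hf⟩ =>
    ⟨f, traverses_map.2 ⟨a, b, rfl, rfl, hf⟩⟩
  have hrad : (G.map c).WithinRadius i u := by
    intro x' hx'
    obtain ⟨x, rfl, hx⟩ := incident_map.1 hx'
    by_cases hxS : x ∈ S
    · rw [hcS hxS]
      exact ⟨.refl _ _, .refl _ _⟩
    have hxu : x ≠ u := fun h => hxS (h ▸ huS)
    constructor
    -- The first step from `u` lands in `S` and is saved by the contraction.
    · rcases (hr x hx).1.eq_or_head with h | ⟨z, ⟨f, hf⟩, hz⟩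
      · exact absurd h.symm hxu
      · have := hz.map c hstep
        rwa [hcS (hNS f z (Or.inl hf))] at this
    · rcases (hr x hx).2.flip.eq_or_head with h | ⟨z, ⟨f, hf⟩, hz⟩
      · exact absurd h.symm hxu
      · have := hz.flip.map c hstep
        rwa [hcS (hNS f z (Or.inr hf))] at this
  obtain ⟨D', hD', hx'⟩ := h (G.map c) u (hG.map c) hrad
  let F : E → V → V → Prop := fun e x y =>
    D e x y ∨ (G.Traverses e x y ∧ c x ≠ c y ∧ D' e (c x) (c y))
  have hDc : ∀ {e x y}, D e x y → c x = c y := fun hd =>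
    (hcS (hDS _ _ _ hd).1).trans (hcS (hDS _ _ _ hd).2).symm
  have hlift : ∀ e x' y', D' e x' y' → x' ≠ y' → ∃ x y, c x = x' ∧ c y = y' ∧ F e x y := by
    intro e x' y' hd hne
    obtain ⟨x, y, rfl, rfl, he⟩ := traverses_map.1 (hD'.traverses _ _ _ hd)
    exact ⟨x, y, rfl, rfl, Or.inr ⟨he, hne, hd⟩⟩
  refine ⟨F, ⟨?_, ?_⟩, ?_⟩
  · rintro e x y (h | h)
    exacts [hD.traverses _ _ _ h, h.1]
  · rintro e x y (h | h) (h' | h')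
    · exact hD.antisymm _ _ _ h h'
    · exact absurd (hDc h).symm h'.2.1
    · exact absurd (hDc h').symm h.2.1
    · exact absurd (hD'.antisymm _ _ _ h.2.2 h'.2.2) h.2.1
  · intro x hx
    have hxm := hx' (c x) (incident_map.2 ⟨x, rfl, hx⟩)
    constructor
    · have hl := Reach.lift (R := fun a b => ∃ e, F e b a) (a := 2 * m - 1) (u := u)
        (fun x' y' ⟨e, hd⟩ hne => by
          obtain ⟨a, b, ha, hb, hF⟩ := hlift e y' x' hd hne.symm
          exact ⟨b, a, hb, ha, e, hF⟩) hcinj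
        (fun x hxu => ((hS x (hcu hxu)).1.mono fun a b ⟨e, he⟩ => ⟨e, Or.inl he⟩).flip)
        hxm.1.flip x rfl
      exact hl.flip.mono_le (by omega)
    · have hl := Reach.lift (R := fun a b => ∃ e, F e a b) (a := m) (u := u)
        (fun x' y' ⟨e, hd⟩ hne => by
          obtain ⟨a, b, ha, hb, hF⟩ := hlift e x' y' hd hne
          exact ⟨a, b, ha, hb, e, hF⟩) hcinj
        (fun x hxu => (hS x (hcu hxu)).2.mono fun a b ⟨e, he⟩ => ⟨e, Or.inl he⟩)
        hxm.2 x rfl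
      exact hl.mono_le (by omega)

theorem OrientBound.succ_of_le [Finite E] (h : OrientBound V E n i A B)
    (hA : A + (2 * min n (2 * (i + 1)) - 1) ≤ A') (hB : B + min n (2 * (i + 1)) ≤ B') :
    OrientBound V E n (i + 1) A' B' :=
  h.succ.mono hA hB

/-- Radius `j` costs at most `4j - 1` on one side and `2j` on the other. Giving the larger cost to
`A`, `B`, `B`, `A` in turn makes the differences `2j - 1` cancel exactly. -/
theorem OrientBound.add_four [Finite E] (h : OrientBound V E n i A B) :
    OrientBound V E n (i + 4) (A + (12 * i + 28)) (B + (12 * i + 28)) := by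
  have h1 := h.succ_of_le (A' := A + (4 * i + 3)) (B' := B + (2 * i + 2)) (by omega) (by omega)
  have h2 := h1.symm.succ_of_le (A' := B + (6 * i + 9)) (B' := A + (6 * i + 7))
    (by omega) (by omega)
  have h3 := h2.succ_of_le (A' := B + (10 * i + 20)) (B' := A + (8 * i + 13)) (by omega) (by omega)
  exact h3.symm.succ_of_le (by omega) (by omega)

theorem exists_orientBound_sq [Finite E] (V : Type*) (n : ℕ) : ∀ r : ℕ, ∃ A B,
    OrientBound V E n r A B ∧ 2 * A ≤ 3 * r ^ 2 + 2 * r + 2 ∧ 2 * B ≤ 3 * r ^ 2 + 2 * r + 2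
  | 0 => ⟨0, 0, orientBound_zero, by omega, by omega⟩
  | 1 => ⟨3, 2, orientBound_zero.succ_of_le (by omega) (by omega), by omega, by omega⟩
  | 2 => by
    have h1 : OrientBound V E n 1 3 2 := orientBound_zero.succ_of_le (by omega) (by omega)
    exact ⟨9, 7, h1.symm.succ_of_le (by omega) (by omega), by omega, by omega⟩
  | 3 => by
    have h1 : OrientBound V E n 1 3 2 := orientBound_zero.succ_of_le (by omega) (by omega)
    have h2 : OrientBound V E n 2 10 6 := h1.succ_of_le (by omega) (by omega)
    exact ⟨17, 16, h2.symm.succ_of_le (by omega) (by omega), by omega, by omega⟩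
  | r + 4 => by
    obtain ⟨A, B, h, hA, hB⟩ := exists_orientBound_sq V n r
    exact ⟨_, _, h.add_four, by nlinarith, by nlinarith⟩

theorem exists_orientBound_mul [Finite E] (V : Type*) (n : ℕ) : ∀ r : ℕ, ∃ A B,
    OrientBound V E n r A B ∧ 2 * A ≤ 3 * r * (n + 1) ∧ 2 * B ≤ 3 * r * (n + 1)
  | 0 => ⟨0, 0, orientBound_zero, by omega, by omega⟩
  -- For odd `r` the unpaired level is the innermost one. The cap `2` is essential there: `2 * (2n -
  -- 1) ≤ 3 * (n + 1)` fails for large `n`.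
  | 1 => ⟨2 * min n 2 - 1, min n 2, orientBound_zero.succ_of_le (by omega) (by omega),
      by omega, by omega⟩
  | r + 2 => by
    obtain ⟨A, B, h, hA, hB⟩ := exists_orientBound_mul V n r
    have h1 := h.succ_of_le (A' := A + 2 * n) (B' := B + n) (by omega) (by omega)
    have h2 := h1.symm.succ_of_le (A' := B + 3 * n) (B' := A + 3 * n) (by omega) (by omega)
    exact ⟨_, _, h2, by nlinarith, by nlinarith⟩

/-! ### From partial orientations to the oriented radius -/

/-- A partial orientation extends to an orientation. -/
theorem IsPartialOrientation.exists_orientation {D : E → V → V → Prop}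
    (hD : G.IsPartialOrientation D) :
    ∃ H : MixedGraph V E, G.IsOrientation H ∧ ∀ e x y, D e x y → H.Traverses e x y := by
  have hex : ∀ e, ∃ p : V × V, G.Traverses e p.1 p.2 ∧ ∀ x y, D e x y → p = (x, y) := by
    intro e
    by_cases h : ∃ x y, D e x y
    · obtain ⟨x, y, h⟩ := h
      refine ⟨(x, y), hD.traverses _ _ _ h, fun x' y' h' => ?_⟩
      rcases (hD.traverses _ _ _ h).eq_or_swap (hD.traverses _ _ _ h') with ⟨rfl, rfl⟩ | ⟨rfl, rfl⟩
      · rfl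
      · rw [hD.antisymm _ _ _ h h']
    · push Not at h
      rcases he : G.ends e with s | ⟨a, b⟩
      · induction s using Sym2.ind with
        | _ a b => exact ⟨(a, b), Or.inl he, fun x y hxy => absurd hxy (h x y)⟩
      · exact ⟨(a, b), Or.inr he, fun x y hxy => absurd hxy (h x y)⟩
  choose p hp hpD using hex
  exact ⟨⟨fun e => Sum.inr (p e)⟩, fun e => ⟨(p e).1, (p e).2, hp e, rfl⟩,
    fun e x y h => Or.inr (congrArg Sum.inr (hpD e x y h))⟩

theorem dist_le_of_reach (h : Reach G.Step n x y) : G.dist x y ≤ n := by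
  suffices hw : ∃ p : G.Walk x y, p.length ≤ n by
    obtain ⟨p, hp⟩ := hw
    exact (iInf_le _ p).trans (by exact_mod_cast hp)
  induction h with
  | refl n x => exact ⟨.nil x, Nat.zero_le _⟩
  | head h _ ih =>
    obtain ⟨e, he⟩ := h
    obtain ⟨p, hp⟩ := ih
    refine ⟨.cons e he p, ?_⟩
    simp only [Walk.length, Walk.edges, List.length_cons] at hp ⊢
    omega

theorem Walk.reach (p : G.Walk x y) : Reach G.Step p.length x y := by
  induction p with
  | nil x => exact .refl _ _
  | cons e h p ih => exact .head ⟨e, h⟩ ih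

theorem reach_of_dist_le (h : G.dist x y ≤ n) : Reach G.Step n x y := by
  have hlt : G.dist x y < (n : ℕ∞) + 1 :=
    lt_of_le_of_lt h (by exact_mod_cast Nat.lt_succ_self n)
  obtain ⟨p, hp⟩ := iInf_lt_iff.1 hlt
  have hp' : p.length < n + 1 := by exact_mod_cast hp
  exact p.reach.mono_le (by omega)

theorem exists_reach_of_radius_eq {r : ℕ} (h : G.radius = r) :
    ∃ u, ∀ x, Reach G.Step r u x ∧ Reach G.Step r x u := by
  have hlt : G.radius < (r : ℕ∞) + 1 := by
    rw [h]
    exact_mod_cast Nat.lt_succ_self r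
  obtain ⟨u, hu⟩ := iInf_lt_iff.1 hlt
  have hle : G.ecc u ≤ r := Order.le_of_lt_add_one hu
  obtain ⟨h1, h2⟩ := max_le_iff.1 hle
  exact ⟨u, fun x => ⟨reach_of_dist_le (iSup_le_iff.1 h1 x), reach_of_dist_le (iSup_le_iff.1 h2 x)⟩⟩

theorem OrientBound.orientedRadius_le {r : ℕ} (h : OrientBound V E n r A B)
    (hG : G.AllCloseUp n) (hr : G.radius = r) : G.orientedRadius ≤ max A B := by
  obtain ⟨u, hu⟩ := exists_reach_of_radius_eq hr
  obtain ⟨D, hD, hx⟩ := h G u hG fun x _ => hu x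
  obtain ⟨H, hH, hDH⟩ := hD.exists_orientation
  have hinc : ∀ x, x ≠ u → G.Incident x := by
    intro x hxu
    cases (hu x).2 with
    | refl => exact absurd rfl hxu
    | head h _ =>
      obtain ⟨e, he⟩ := h
      exact he.incident_left
  have hstep : ∀ a b, (∃ e, D e a b) → H.Step a b := fun a b ⟨e, he⟩ => ⟨e, hDH e a b he⟩
  have hreach : ∀ x, Reach H.Step A u x ∧ Reach H.Step B x u := by
    intro x
    by_cases hxu : x = u
    · subst hxu
      exact ⟨.refl _ _, .refl _ _⟩
    · exact ⟨(hx x (hinc x hxu)).1.mono hstep, (hx x (hinc x hxu)).2.mono hstep⟩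
  calc G.orientedRadius ≤ H.radius :=
        iInf_le (fun H : {H : MixedGraph V E // G.IsOrientation H} => H.1.radius) ⟨H, hH⟩
    _ ≤ H.ecc u := iInf_le _ u
    _ ≤ max A B := max_le_max (iSup_le fun x => dist_le_of_reach (hreach x).1)
        (iSup_le fun x => dist_le_of_reach (hreach x).2)

theorem TwoEdgeConnected.allCloseUp {r : ℕ} (h : G.TwoEdgeConnected) (hr : G.radius = r) :
    G.AllCloseUp (2 * r) := by
  obtain ⟨u, hu⟩ := exists_reach_of_radius_eq hr
  intro e x y he hne
  refine WithinRadius.closesUp (u := u) (fun x _ => hu x) he fun he' => ?_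
  have hinl : ∃ s, G.ends e = Sum.inl s := by
    rcases he with he | he
    · exact ⟨_, he⟩
    rcases he' with he' | he'
    · exact ⟨_, he'⟩
    · rw [he] at he'
      simp only [Sum.inr.injEq, Prod.mk.injEq] at he'
      exact absurd he'.1 hne
  have hconn : (G.deleteEdge e).Connected := by
    by_contra hn
    exact h.2 e ⟨hinl, hn⟩
  refine Relation.ReflTransGen.mono ?_ _ _ (hconn.2 y x)
  rintro a b ⟨⟨f, hf⟩, hab | hab⟩
  exacts [Or.inl ⟨f, hf, hab⟩, Or.inr ⟨f, hf, hab⟩]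

theorem Walk.reach_stepAvoiding (p : G.Walk x y) (he : e ∉ p.edges) :
    Reach (G.StepAvoiding e) p.length x y := by
  induction p with
  | nil x => exact .refl _ _
  | cons f h p ih =>
    simp only [Walk.edges, List.mem_cons, not_or] at he
    exact .head ⟨f, fun h => he.1 h.symm, h⟩ (ih he.2)

theorem Walk.exists_split (p : G.Walk x y) (hp : p.edges.Nodup) (he : e ∈ p.edges) :
    ∃ a b k l, G.Traverses e a b ∧ k + 1 + l = p.length ∧
      Reach (G.StepAvoiding e) k x a ∧ Reach (G.StepAvoiding e) l b y := by
  induction p with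
  | nil x => simp [Walk.edges] at he
  | @cons x z y f h p ih =>
    simp only [Walk.edges, List.nodup_cons] at hp
    by_cases hfe : f = e
    · subst hfe
      exact ⟨x, z, 0, p.length, h, by simp [Walk.length, Walk.edges]; omega, .refl _ _,
        p.reach_stepAvoiding hp.1⟩
    · have he' : e ∈ p.edges := by
        simp only [Walk.edges, List.mem_cons] at he
        exact he.resolve_left fun h => hfe h.symm
      obtain ⟨a, b, k, l, hab, hkl, h1, h2⟩ := ih hp.2 he'
      refine ⟨a, b, k + 1, l, hab, ?_, .head ⟨f, hfe, h⟩ h1, h2⟩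
      simp only [Walk.length, Walk.edges, List.length_cons] at hkl ⊢
      omega

theorem LiesInCycleOfLengthLE.closesUp {η : ℕ} (h : G.LiesInCycleOfLengthLE e η) :
    1 ≤ η ∧ G.ClosesUp (η - 1) e := by
  obtain ⟨x, p, hp, he, hlen⟩ := h
  obtain ⟨a, b, k, l, hab, hkl, h1, h2⟩ := p.exists_split hp.edges_nodup he
  exact ⟨by omega, a, b, hab, (h2.trans h1).mono_le (by omega)⟩

end MixedGraph

open MixedGraph in
theorem mainTheorem3 {V E : Type*} [Finite V] [Finite E] (G : MixedGraph V E) (r : ℕ)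
    (hr : G.radius = (r : ℕ∞)) :
    (G.TwoEdgeConnected →
      ∃ n : ℕ, G.orientedRadius = (n : ℕ∞) ∧ (n : ℝ) ≤ 1.5 * (r : ℝ) ^ 2 + (r : ℝ) + 1) ∧
    (∀ η : ℕ, (∀ e : E, G.LiesInCycleOfLengthLE e η) →
      ∃ n : ℕ, G.orientedRadius = (n : ℕ∞) ∧ (n : ℝ) ≤ 1.5 * (r : ℝ) * (η : ℝ)) := by
  have hfin : ∀ A B : ℕ, G.orientedRadius ≤ max (A : ℕ∞) B →
      ∃ n : ℕ, G.orientedRadius = (n : ℕ∞) ∧ n ≤ max A B := by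
    intro A B h
    have hmax : max (A : ℕ∞) B = ((max A B : ℕ) : ℕ∞) := by norm_cast
    rw [hmax] at h
    obtain ⟨n, hn⟩ := ENat.ne_top_iff_exists.1 (ne_top_of_le_ne_top (ENat.natCast_ne_top _) h)
    refine ⟨n, hn.symm, ?_⟩
    rw [← hn] at h
    exact_mod_cast h
  constructor
  · intro h2
    obtain ⟨A, B, h, hA, hB⟩ := exists_orientBound_sq (E := E) V (2 * r) r
    obtain ⟨n, hn, hle⟩ := hfin A B (h.orientedRadius_le (h2.allCloseUp hr) hr)
    have hn2 : 2 * n ≤ 3 * r ^ 2 + 2 * r + 2 := by omega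
    have hn2' : (2 : ℝ) * n ≤ 3 * r ^ 2 + 2 * r + 2 := by exact_mod_cast hn2
    exact ⟨n, hn, by linarith⟩
  · intro η hη
    rcases Nat.eq_zero_or_pos η with rfl | hpos
    -- For `η = 0` there are no edges; this case is separate because `η - 1` truncates.
    · have hG : G.AllCloseUp 0 := fun e _ _ _ _ => absurd (hη e).closesUp.1 (by omega)
      obtain ⟨n, hn, hle⟩ := hfin 0 0
        ((orientBound_of_closesUp_zero (i := r)).orientedRadius_le hG hr)
      obtain rfl : n = 0 := by omega
      exact ⟨0, hn, by simp⟩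
    · have hG : G.AllCloseUp (η - 1) := fun e _ _ _ _ => (hη e).closesUp.2
      obtain ⟨A, B, h, hA, hB⟩ := exists_orientBound_mul (E := E) V (η - 1) r
      obtain ⟨n, hn, hle⟩ := hfin A B (h.orientedRadius_le hG hr)
      rw [Nat.sub_add_cancel hpos] at hA hB
      have hn2 : 2 * n ≤ 3 * r * η := by omega
      have hn2' : (2 : ℝ) * n ≤ 3 * r * η := by exact_mod_cast hn2
      exact ⟨n, hn, by linarith⟩
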